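/- Let $X$ be a compact Hausdorff space in which every point has a countable base of neighbourhoods (that is, $\chi(X)\le\aleph_0$). Let $(\Gamma_i)_{i\in I}$ be an arbitrary family of Čech-complete topological groups and let $G$ be a subgroup of the product $\prod_{i\in I}\Gamma_i$ (not necessarily closed), with the topology induced by the product topology. Suppose that at least one of the following holds: (1) $X$ is a coset space of $G$, i.e. $X$ is homeomorphic to $G/H$ with the quotient topology for some subgroup $H$ of $G$; (2) there is a continuous transitive action $G\times X\to X$ which is $d$-open, i.e. $x\in\operatorname{Int}(\operatorname{cl}(Ox))$ for every $x\in X$ and every neighbourhood $O$ of the unit of $G$. Then $X$ is metrizable. (A topological space is Čech-complete if it is Tychonoff and is a $G_\delta$-subset of its Stone–Čech compactification.) -/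

import Mathlib

open Topology

/-- A space is Čech-complete if it is Tychonoff and it is a `Gδ` subset of its
Stone–Čech compactification. -/
def IsCechComplete (Y : Type*) [TopologicalSpace Y] : Prop :=
  T35Space Y ∧ IsGδ (Set.range (stoneCechUnit : Y → StoneCech Y))

/-- `X` is a coset space of the topological group `G`: it is homeomorphic to the space `G ⧸ H` of
left cosets of a subgroup `H`, with the quotient topology.
(If `X` is Hausdorff, then such an `H` is automatically closed.) -/
def IsCosetSpaceOf (G X : Type*) [Group G] [TopologicalSpace G] [TopologicalSpace X] : Prop :=
  ∃ H : Subgroup G, Nonempty (X ≃ₜ G ⧸ H)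

/-- An action of `G` on `X` is `d`-open if `x` is an interior point of the closure of `O x`, for
every point `x` of `X` and every neighbourhood `O` of the unit of `G`. -/
def IsDOpenAction (G X : Type*) [Group G] [TopologicalSpace G] [TopologicalSpace X]
    [MulAction G X] : Prop :=
  ∀ x : X, ∀ O ∈ 𝓝 (1 : G), x ∈ interior (closure ((fun g : G => g • x) '' O))

/-- `G` admits a (jointly) continuous, transitive and `d`-open action on `X`. -/
def HasTransitiveDOpenAction (G X : Type*) [Group G] [TopologicalSpace G]
    [TopologicalSpace X] : Prop :=
  ∃ _ : MulAction G X,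
    ContinuousSMul G X ∧ MulAction.IsPretransitive G X ∧ IsDOpenAction G X

open Filter Set Pointwise Uniformity

/-! Suppose first that the acting group has a sequence of neighbourhoods of the unit that forces
ultrafilters to converge. Refined to a normal sequence `W`, it has a compact intersection `K`, and
the `W n` form a base at `K`. By `d`-openness some countable `D` has `K D` dense in `X`. First
countability at the points of `D` and compactness of `K` allow `W` to be shrunk until its
intersection fixes `K D` pointwise, hence acts trivially. Then the `W n` move points uniformly
little, and the closures of the sets `W n x` yield a countable base of the uniformity
(`IsDOpenAction.metrizableSpace`).

In general, continuity of one orbit map at the unit involves only countably many coordinates, and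
for a `d`-open action it already gives joint continuity (`IsDOpenAction.continuousSMul`). So `G` may
be retopologized from a countable subproduct, and the action extends to the closure of its image
there (`exists_continuousSMul_extension`), where the first case applies. -/

/-! ### Čech-completeness as convergence of ultrafilters -/

/-- There is a sequence of neighbourhoods of the unit such that every ultrafilter containing all of
them converges. -/
def HasCompleteSequenceAtOne (Y : Type*) [One Y] [TopologicalSpace Y] : Prop :=
  ∃ V : ℕ → Set Y, (∀ n, V n ∈ 𝓝 (1 : Y)) ∧
    ∀ F : Ultrafilter Y, (∀ n, V n ∈ F) → ∃ y, (F : Filter Y) ≤ 𝓝 y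

theorem HasCompleteSequenceAtOne.of_countable {Y κ : Type*} [One Y] [TopologicalSpace Y]
    [Countable κ] (V : κ → Set Y) (hV : ∀ k, V k ∈ 𝓝 (1 : Y))
    (hF : ∀ F : Ultrafilter Y, (∀ k, V k ∈ F) → ∃ y, (F : Filter Y) ≤ 𝓝 y) :
    HasCompleteSequenceAtOne Y := by
  -- `Option κ` is nonempty even when `κ` is empty; the extra index receives `univ`.
  obtain ⟨e, he⟩ := exists_surjective_nat (Option κ)
  refine ⟨fun n => (e n).elim univ V, fun n => ?_, fun F h => hF F fun k => ?_⟩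
  · cases h : e n with
    | none => simp [h]
    | some k => simpa [h] using hV k
  · obtain ⟨n, hn⟩ := he (some k)
    simpa [hn] using h n

theorem IsCechComplete.hasCompleteSequenceAtOne {Y : Type*} [One Y] [TopologicalSpace Y]
    (hY : IsCechComplete Y) : HasCompleteSequenceAtOne Y := by
  obtain ⟨_, hG⟩ := hY
  obtain ⟨O, hO, hrange⟩ := isGδ_iff_eq_iInter_nat.1 hG
  have key : ∀ n, ∃ C ∈ 𝓝 (stoneCechUnit (1 : Y)), IsClosed C ∧ C ⊆ O n := fun n =>
    exists_mem_nhds_isClosed_subset ((hO n).mem_nhds <|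
      mem_iInter.1 (hrange ▸ mem_range_self (1 : Y)) n)
  choose C hC hCc hCO using key
  refine ⟨fun n => stoneCechUnit ⁻¹' C n,
    fun n => continuous_stoneCechUnit.continuousAt.preimage_mem_nhds (hC n), fun F hF => ?_⟩
  obtain ⟨p, -, hp⟩ := isCompact_univ.ultrafilter_le_nhds (F.map stoneCechUnit) (by simp)
  -- Closed neighbourhoods inside the `O n` trap the limit in their intersection, which is `Y`.
  have hpr : p ∈ range (stoneCechUnit : Y → StoneCech Y) := by
    rw [hrange, mem_iInter]
    exact fun n => hCO n ((hCc n).mem_of_tendsto hp (hF n))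
  obtain ⟨y, rfl⟩ := hpr
  refine ⟨y, ?_⟩
  rw [isInducing_stoneCechUnit.nhds_eq_comap]
  exact map_le_iff_le_comap.1 hp

theorem HasCompleteSequenceAtOne.pi {κ : Type*} [Countable κ] {Y : κ → Type*}
    [∀ k, One (Y k)] [∀ k, TopologicalSpace (Y k)]
    (h : ∀ k, HasCompleteSequenceAtOne (Y k)) : HasCompleteSequenceAtOne (∀ k, Y k) := by
  choose V hV hF using h
  refine .of_countable (κ := κ × ℕ) (fun p => (fun f => f p.1) ⁻¹' V p.1 p.2)
    (fun p => (continuous_apply p.1).continuousAt.preimage_mem_nhds (hV p.1 p.2))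
    fun F h => ?_
  choose y hy using fun k => hF k (F.map fun f : ∀ k, Y k => f k) fun n =>
    h (k, n)
  exact ⟨y, tendsto_pi_nhds.2 hy⟩

theorem HasCompleteSequenceAtOne.subgroup {P : Type*} [Group P] [TopologicalSpace P]
    (h : HasCompleteSequenceAtOne P) (Q : Subgroup P) (hQ : IsClosed (Q : Set P)) :
    HasCompleteSequenceAtOne Q := by
  obtain ⟨V, hV, hF⟩ := h
  refine ⟨fun n => Subtype.val ⁻¹' V n,
    fun n => continuous_subtype_val.continuousAt.preimage_mem_nhds (hV n), fun F h => ?_⟩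
  obtain ⟨y, hy⟩ := hF (F.map Subtype.val) h
  have hyQ : y ∈ Q := hQ.mem_of_tendsto hy (Eventually.of_forall fun q => q.2)
  refine ⟨⟨y, hyQ⟩, ?_⟩
  rw [IsInducing.subtypeVal.nhds_eq_comap]
  exact map_le_iff_le_comap.1 hy

/-! ### Normal sequences and `d`-open actions -/

/-- A sequence of closed symmetric neighbourhoods of the unit with `W (n + 1) ^ 2 ⊆ W n`. -/
structure IsNormalSequence {G : Type*} [Group G] [TopologicalSpace G] (W : ℕ → Set G) : Prop where
  mem_nhds : ∀ n, W n ∈ 𝓝 (1 : G)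
  isClosed : ∀ n, IsClosed (W n)
  inv_mem : ∀ {n g}, g ∈ W n → g⁻¹ ∈ W n
  mul_mem : ∀ {n g h}, g ∈ W (n + 1) → h ∈ W (n + 1) → g * h ∈ W n

/-- Left multiplication by `h` maps `closure (O x)` into `closure (O' x)` when `h O ⊆ O'`. -/
theorem smul_mem_closure_image {G X : Type*} [Group G] [TopologicalSpace X] [MulAction G X]
    [ContinuousConstSMul G X] {O O' : Set G} {h : G} {x y : X}
    (hO : ∀ g ∈ O, h * g ∈ O') (hy : y ∈ closure ((fun g : G => g • x) '' O)) :
    h • y ∈ closure ((fun g : G => g • x) '' O') := by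
  refine map_mem_closure (continuous_const_smul h) hy ?_
  rintro _ ⟨g, hg, rfl⟩
  exact ⟨h * g, hO g hg, mul_smul h g x⟩

section Group

variable {G : Type*} [Group G] [TopologicalSpace G]

theorem exists_isNormalSequence [IsTopologicalGroup G] (V : ℕ → Set G)
    (hV : ∀ n, V n ∈ 𝓝 (1 : G)) : ∃ W, IsNormalSequence W ∧ ∀ n, W n ⊆ V n := by
  have step : ∀ U : {U : Set G // U ∈ 𝓝 (1 : G)}, ∃ U' : {U : Set G // U ∈ 𝓝 (1 : G)},
      IsClosed U'.1 ∧ U'.1⁻¹ = U'.1 ∧ U'.1 * U'.1 ⊆ U.1 := fun U => by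
    obtain ⟨U', h1, h2⟩ := exists_closed_nhds_one_inv_eq_mul_subset U.2
    exact ⟨⟨U', h1⟩, h2⟩
  choose f hfc hfi hfm using step
  have one_mem (U : {U : Set G // U ∈ 𝓝 (1 : G)}) : (1 : G) ∈ U.1 := mem_of_mem_nhds U.2
  let S : ℕ → {U : Set G // U ∈ 𝓝 (1 : G)} := fun n =>
    n.rec (f ⟨V 0, hV 0⟩) fun n U => f ⟨U.1 ∩ V (n + 1), inter_mem U.2 (hV (n + 1))⟩
  have hS (n : ℕ) : S (n + 1) = f ⟨(S n).1 ∩ V (n + 1), inter_mem (S n).2 (hV (n + 1))⟩ := rfl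
  have hf (U) : (f U).1 ⊆ U.1 := fun g hg =>
    hfm U (by simpa using mul_mem_mul hg (one_mem (f U)))
  refine ⟨fun n => (S n).1, ⟨fun n => (S n).2, fun n => ?_, fun {n g} hg => ?_,
    fun {n g h} hg hh => ?_⟩, fun n => ?_⟩
  · cases n
    exacts [hfc _, hfc _]
  · cases n
    · exact (hfi ⟨V 0, hV 0⟩) ▸ Set.inv_mem_inv.2 hg
    · rename_i n
      simp only [hS] at hg ⊢
      rw [← hfi]
      exact Set.inv_mem_inv.2 hg
  · simp only [hS] at hg hh
    exact (hfm _ (mul_mem_mul hg hh)).1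
  · cases n
    exacts [hf _, (hf _).trans inter_subset_right]

namespace IsNormalSequence

variable {W : ℕ → Set G} (hW : IsNormalSequence W)
include hW

theorem one_mem (n : ℕ) : (1 : G) ∈ W n := mem_of_mem_nhds (hW.mem_nhds n)

theorem antitone : Antitone W :=
  antitone_nat_of_succ_le fun n g hg => by simpa using hW.mul_mem hg (hW.one_mem (n + 1))

/-- Otherwise an ultrafilter containing every `W n \ U` converges to a point of `⋂ n, W n ⊆ U`, yet
avoids the open set `U`. -/
theorem exists_subset {V : ℕ → Set G} (hWV : ∀ n, W n ⊆ V n)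
    (hF : ∀ F : Ultrafilter G, (∀ n, V n ∈ F) → ∃ y, (F : Filter G) ≤ 𝓝 y)
    {U : Set G} (hU : IsOpen U) (h : ⋂ n, W n ⊆ U) : ∃ n, W n ⊆ U := by
  by_contra! hn
  have hne : (⨅ n, 𝓟 (W n \ U)).NeBot := by
    refine iInf_neBot_of_directed (fun i j => ⟨max i j, ?_, ?_⟩) fun n => ?_
    · exact principal_mono.2 (sdiff_subset_sdiff_left (hW.antitone (le_max_left i j)))
    · exact principal_mono.2 (sdiff_subset_sdiff_left (hW.antitone (le_max_right i j)))
    · exact principal_neBot_iff.2 (not_subset.1 (hn n))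
  have hmem (n : ℕ) : W n \ U ∈ Ultrafilter.of (⨅ n, 𝓟 (W n \ U)) :=
    Ultrafilter.of_le _ (mem_iInf_of_mem n (mem_principal_self _))
  obtain ⟨y, hy⟩ := hF _ fun n => mem_of_superset (hmem n) (sdiff_subset.trans (hWV n))
  have hyW : y ∈ ⋂ n, W n := mem_iInter.2 fun n =>
    (hW.isClosed n).mem_of_tendsto (f := id) hy (mem_of_superset (hmem n) sdiff_subset)
  obtain ⟨z, hz⟩ := (Ultrafilter.of (⨅ n, 𝓟 (W n \ U))).neBot.nonempty_of_mem
    (inter_mem (hmem 0) (hy (hU.mem_nhds (h hyW))))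
  exact hz.1.2 hz.2

theorem isCompact_iInter {V : ℕ → Set G} (hWV : ∀ n, W n ⊆ V n)
    (hF : ∀ F : Ultrafilter G, (∀ n, V n ∈ F) → ∃ y, (F : Filter G) ≤ 𝓝 y) :
    IsCompact (⋂ n, W n) := by
  rw [isCompact_iff_ultrafilter_le_nhds]
  intro F hFW
  have hmem (n : ℕ) : W n ∈ F := hFW (mem_principal.2 (iInter_subset W n))
  obtain ⟨y, hy⟩ := hF F fun n => mem_of_superset (hmem n) (hWV n)
  exact ⟨y, mem_iInter.2 fun n => (hW.isClosed n).mem_of_tendsto (f := id) hy (hmem n), hy⟩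

end IsNormalSequence

variable {X : Type*} [TopologicalSpace X] [MulAction G X]

theorem IsDOpenAction.closure_mem_nhds (hd : IsDOpenAction G X) {O : Set G} (hO : O ∈ 𝓝 (1 : G))
    (x : X) : closure ((fun g : G => g • x) '' O) ∈ 𝓝 x :=
  mem_interior_iff_mem_nhds.1 (hd x O hO)

namespace IsNormalSequence

variable {W : ℕ → Set G} (hW : IsNormalSequence W) (hd : IsDOpenAction G X)
  [ContinuousConstSMul G X]
include hW

theorem mem_closure_trans {n : ℕ} {x y z : X}
    (hy : y ∈ closure ((fun g : G => g • x) '' W (n + 1)))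
    (hz : z ∈ closure ((fun g : G => g • y) '' W (n + 1))) :
    z ∈ closure ((fun g : G => g • x) '' W n) := by
  refine closure_minimal ?_ isClosed_closure hz
  rintro _ ⟨g, hg, rfl⟩
  exact smul_mem_closure_image (fun h hh => hW.mul_mem hg hh) hy

include hd

theorem mem_closure_symm {n : ℕ} {x y : X}
    (hy : y ∈ closure ((fun g : G => g • x) '' W (n + 1))) :
    x ∈ closure ((fun g : G => g • y) '' W n) := by
  obtain ⟨_, hz, g, hg, rfl⟩ :=
    mem_closure_iff_nhds.1 hy _ (hd.closure_mem_nhds (hW.mem_nhds (n + 1)) y)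
  simpa using smul_mem_closure_image (fun h hh => hW.mul_mem (hW.inv_mem hg) hh) hz

end IsNormalSequence

end Group

/-! ### Joint continuity from one orbit map -/

section JointContinuity

variable {G X : Type*} [Group G] [TopologicalSpace G] [IsTopologicalGroup G]
  [TopologicalSpace X] [MulAction G X] [ContinuousConstSMul G X]

/-- Conjugation carries continuity at `x₀` to every orbit map. Near `(1, x)`, the closure of `O x`
is a neighbourhood of `x` by `d`-openness, and `O` moves it into the closure of `O O x`. -/
theorem IsDOpenAction.continuousSMul [RegularSpace X] [MulAction.IsPretransitive G X]
    (hd : IsDOpenAction G X) {x₀ : X} (h₀ : Tendsto (fun g : G => g • x₀) (𝓝 1) (𝓝 x₀)) :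
    ContinuousSMul G X := by
  have orbit (x : X) : Tendsto (fun g : G => g • x) (𝓝 1) (𝓝 x) := by
    obtain ⟨h, rfl⟩ := MulAction.exists_smul_eq G x₀ x
    have hc : Tendsto (fun g : G => h⁻¹ * g * h) (𝓝 1) (𝓝 1) := by
      have : Continuous fun g : G => h⁻¹ * g * h := by fun_prop
      simpa using this.tendsto 1
    refine (((continuous_const_smul h).tendsto x₀).comp (h₀.comp hc)).congr fun g => ?_
    simp [smul_smul, mul_assoc]
  have joint (x : X) : Tendsto (fun p : G × X => p.1 • p.2) (𝓝 (1, x)) (𝓝 x) := by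
    refine (closed_nhds_basis x).tendsto_right_iff.2 fun U hU => ?_
    obtain ⟨O, hO, -, -, hOO⟩ := exists_closed_nhds_one_inv_eq_mul_subset (orbit x hU.1)
    rw [nhds_prod_eq]
    filter_upwards [prod_mem_prod hO (hd.closure_mem_nhds hO x)] with p hp
    refine hU.2.closure_subset_iff.2 ?_
      (smul_mem_closure_image (O' := O * O) (fun g hg => mul_mem_mul hp.1 hg) hp.2)
    rintro _ ⟨g, hg, rfl⟩
    exact hOO hg
  refine ⟨continuous_iff_continuousAt.2 fun ⟨g, x⟩ => ?_⟩
  have hc : Tendsto (fun p : G × X => (g⁻¹ * p.1, p.2)) (𝓝 (g, x)) (𝓝 (1, x)) := by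
    have : Continuous fun p : G × X => (g⁻¹ * p.1, p.2) := by fun_prop
    simpa using this.tendsto (g, x)
  refine (((continuous_const_smul g).tendsto x).comp ((joint x).comp hc)).congr fun p => ?_
  simp [smul_smul]

end JointContinuity

/-! ### Extending the action to a completion -/

section Extension

/-- A continuous action on a compact space extends along a homomorphism that is a dense inducing
map. -/
theorem exists_continuousSMul_extension {G Q X : Type*} [Group G] [TopologicalSpace G]
    [IsTopologicalGroup G] [Group Q] [TopologicalSpace Q] [IsTopologicalGroup Q]
    [TopologicalSpace X] [CompactSpace X] [T2Space X] [MulAction G X] [ContinuousSMul G X]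
    (i : G →* Q) (hi : IsDenseInducing i) :
    ∃ _ : MulAction Q X, ContinuousSMul Q X ∧ ∀ (g : G) (x : X), i g • x = g • x := by
  let _ : UniformSpace X := uniformSpaceOfCompactR1
  let f : G → C(X, X) := fun g => ⟨fun x => g • x, continuous_const_smul g⟩
  have hf : Continuous f :=
    ContinuousMap.continuous_of_continuous_uncurry f (continuous_smul (M := G) (X := X))
  have hlim (q : Q) : ∃ c, Tendsto f (comap i (𝓝 q)) (𝓝 c) := by
    have : (comap i (𝓝 q)).NeBot := hi.comap_nhds_neBot q
    refine CompleteSpace.complete (f := map f (comap i (𝓝 q))) ⟨inferInstance, ?_⟩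
    rw [prod_map_map_eq]
    refine ContinuousMap.hasBasis_compactConvergenceUniformity_of_compact.ge_iff.2 fun V hV => ?_
    -- The maps of `g` and `h` differ by the displacement of `h * g⁻¹`, which is uniformly small
    -- near the unit; so the image filter is Cauchy.
    have hdiv : Tendsto (fun p : G × G => p.2 * p.1⁻¹) (comap i (𝓝 q) ×ˢ comap i (𝓝 q))
        (𝓝 1) := by
      rw [hi.isInducing.nhds_eq_comap, tendsto_comap_iff, map_one]
      have h1 : Tendsto (fun p : G × G => i p.1) (comap i (𝓝 q) ×ˢ comap i (𝓝 q)) (𝓝 q) :=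
        tendsto_comap.comp tendsto_fst
      have h2 : Tendsto (fun p : G × G => i p.2) (comap i (𝓝 q) ×ˢ comap i (𝓝 q)) (𝓝 q) :=
        tendsto_comap.comp tendsto_snd
      simpa [Function.comp_def] using h2.mul h1.inv
    have hV' : ∀ᶠ g in 𝓝 (1 : G), ∀ x : X, (x, g • x) ∈ V := by
      have := hf.tendsto 1 (mem_nhds_left (f 1)
        (ContinuousMap.hasBasis_compactConvergenceUniformity_of_compact.mem_of_mem hV))
      filter_upwards [this] with g hg x
      simpa [f] using hg x
    refine mem_map.2 (mem_of_superset (mem_map.1 (hdiv hV')) fun p hp x => ?_)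
    simpa [f, smul_smul] using (show ∀ x : X, (x, (p.2 * p.1⁻¹) • x) ∈ V from hp) (p.1 • x)
  let F : Q → C(X, X) := hi.extend f
  have hF : Continuous F := hi.continuous_extend hlim
  have hFi (g : G) : F (i g) = f g := hi.extend_eq hf g
  have hmul (p q : Q) : F (p * q) = (F p).comp (F q) := by
    have h : (fun z : Q × Q => F (z.1 * z.2)) = fun z : Q × Q => (F z.1).comp (F z.2) := by
      refine (hi.dense.prodMap hi.dense).equalizer (by fun_prop)
        (ContinuousMap.continuous_comp'.comp
          ((hF.comp continuous_snd).prodMk (hF.comp continuous_fst))) ?_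
      ext z x
      simp [← map_mul, hFi, f, mul_smul]
    exact congrFun h (p, q)
  have hone : F 1 = ContinuousMap.id X := by
    rw [← map_one i, hFi]
    ext x
    simp [f]
  let act : MulAction Q X :=
    { smul := fun q x => F q x
      one_smul := fun x => by
        change F 1 x = x
        simp [hone]
      mul_smul := fun p q x => by
        change F (p * q) x = F p (F q x)
        simp [hmul] }
  refine ⟨act, ⟨?_⟩, fun g x => ?_⟩
  · change Continuous fun p : Q × X => F p.1 p.2
    fun_prop
  · change F (i g) x = g • x
    rw [hFi]
    rfl

end Extension

/-! ### Metrizability under a complete sequence -/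

theorem isOpen_setOf_forall_smul_mem {G X : Type*} [TopologicalSpace G] [TopologicalSpace X]
    [SMul G X] [ContinuousSMul G X] {C U : Set X} (hC : IsCompact C) (hU : IsOpen U) :
    IsOpen {g : G | ∀ x ∈ C, g • x ∈ U} := by
  refine isOpen_iff_eventually.2 fun g hg =>
    hC.eventually_forall_of_forall_eventually fun x hx => ?_
  exact continuous_smul.continuousAt.eventually (hU.mem_nhds (hg x hx))

section Metrizability

variable {G X : Type*} [Group G] [TopologicalSpace G]
  [TopologicalSpace X] [CompactSpace X] [T2Space X] [MulAction G X]

theorem IsDOpenAction.metrizableSpace_of_isNormalSequence [ContinuousConstSMul G X]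
    (hd : IsDOpenAction G X)
    {W : ℕ → Set G} (hW : IsNormalSequence W)
    (hsmall : ∀ E ∈ 𝓝ˢ (diagonal X), ∃ n, ∀ g ∈ W n, ∀ x : X, (x, g • x) ∈ E) :
    TopologicalSpace.MetrizableSpace X := by
  let _ : UniformSpace X := uniformSpaceOfCompactR1
  rw [nhdsSet_diagonal_eq_uniformity] at hsmall
  let E : ℕ → Set (X × X) := fun n => {p | p.2 ∈ closure ((fun g : G => g • p.1) '' W n)}
  have hE (n : ℕ) : E n ∈ 𝓤 X := by
    rw [← nhdsSet_diagonal_eq_uniformity, mem_nhdsSet_iff_forall]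
    rintro ⟨x, y⟩ (rfl : x = y)
    -- One index is lost to symmetry and one to transitivity.
    have hx := hd.closure_mem_nhds (hW.mem_nhds (n + 2)) x
    rw [nhds_prod_eq]
    filter_upwards [prod_mem_prod hx hx] with p hp
    refine hW.mem_closure_trans (hW.mem_closure_symm hd hp.1) ?_
    exact closure_mono (image_mono (hW.antitone (Nat.le_succ _))) hp.2
  have hbasis : (𝓤 X).HasBasis (fun _ : ℕ => True) E := by
    refine ⟨fun S => ⟨fun hS => ?_, fun ⟨n, _, hn⟩ => mem_of_superset (hE n) hn⟩⟩
    obtain ⟨C, ⟨hC, hCc⟩, hCS⟩ := uniformity_hasBasis_closed.mem_iff.1 hS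
    obtain ⟨n, hn⟩ := hsmall C hC
    refine ⟨n, trivial, fun p hp => hCS ?_⟩
    have hcl : IsClosed {y | (p.1, y) ∈ C} := hCc.preimage (by fun_prop)
    refine hcl.closure_subset_iff.2 ?_ hp
    rintro _ ⟨g, hg, rfl⟩
    exact hn g hg p.1
  have : (𝓤 X).IsCountablyGenerated := hbasis.isCountablyGenerated
  exact UniformSpace.metrizableSpace

variable [ContinuousSMul G X]

/-- Some countable set meets every open set invariant under the intersection of a normal sequence
that is a base at its intersection. -/
theorem IsDOpenAction.exists_countable_dense_modulo (hd : IsDOpenAction G X)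
    {W : ℕ → Set G} (hW : IsNormalSequence W)
    (hbase : ∀ U : Set G, IsOpen U → ⋂ n, W n ⊆ U → ∃ n, W n ⊆ U) :
    ∃ D : Set X, D.Countable ∧
      Dense {x | ∃ d ∈ D, ∃ k : G, (∀ n, k ∈ W n) ∧ x = k • d} := by
  have hcover (n : ℕ) := CompactSpace.elim_nhds_subcover
    (fun x : X => closure ((fun g : G => g • x) '' W n))
    (fun x => hd.closure_mem_nhds (hW.mem_nhds n) x)
  choose F hF using hcover
  refine ⟨⋃ n, (F n : Set X), countable_iUnion fun n => (F n).countable_toSet, ?_⟩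
  rw [dense_iff_inter_open]
  rintro U hU ⟨x, hx⟩
  obtain ⟨C, hC, hCU, hCc⟩ := local_compact_nhds (hU.mem_nhds hx)
  let KU : Set X := ⋃ k ∈ ⋂ n, W n, (fun x => k • x) '' U
  have hKU : IsOpen KU := isOpen_biUnion fun k _ => isOpenMap_smul k U hU
  -- Since `K C ⊆ K U` with `C` compact, a single `W n` carries `C` into `K U`.
  obtain ⟨n, hn⟩ := hbase _ (isOpen_setOf_forall_smul_mem hCc hKU) fun k hk y hy =>
    mem_biUnion hk (mem_image_of_mem _ (hCU hy))
  obtain ⟨f, hfF, hxf⟩ : ∃ f ∈ F n, x ∈ closure ((fun g : G => g • f) '' W n) := by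
    simpa using (hF n).ge (mem_univ x)
  obtain ⟨_, hy, g, hg, rfl⟩ := mem_closure_iff_nhds.1 hxf C hC
  have hfK : f ∈ KU := by simpa using hn (hW.inv_mem hg) _ hy
  obtain ⟨k, hk, y, hyU, hkf⟩ := mem_iUnion₂.1 hfK
  exact ⟨y, hyU, f, mem_iUnion.2 ⟨n, hfF⟩, k⁻¹, fun m => hW.inv_mem (mem_iInter.1 hk m),
    eq_inv_smul_iff.2 hkf⟩

theorem IsDOpenAction.metrizableSpace [FirstCountableTopology X] [IsTopologicalGroup G]
    (hG : HasCompleteSequenceAtOne G) (hd : IsDOpenAction G X) :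
    TopologicalSpace.MetrizableSpace X := by
  obtain ⟨V, hV, hF⟩ := hG
  obtain ⟨W, hW, hWV⟩ := exists_isNormalSequence V hV
  have hK := hW.isCompact_iInter hWV hF
  obtain ⟨D, hD, hdense⟩ :=
    hd.exists_countable_dense_modulo hW fun U hU => hW.exists_subset hWV hF hU
  choose B hB using fun x : X => (𝓝 x).exists_antitone_basis
  -- An element of `T (d, m)` for all `m` fixes `k • d` for every `k` in `K`; compactness of `K`
  -- makes each `T p` a neighbourhood.
  let T : X × ℕ → Set G := fun p => {g | ∀ k ∈ ⋂ n, W n, (k⁻¹ * g * k) • p.1 ∈ B p.1 p.2}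
  have hT (p : X × ℕ) : T p ∈ 𝓝 (1 : G) := by
    refine hK.eventually_forall_of_forall_eventually fun k hk => ?_
    have hc : Continuous fun z : G × G => (z.2⁻¹ * z.1 * z.2) • p.1 := by fun_prop
    refine hc.continuousAt.eventually ?_
    simpa using (hB p.1).mem p.2
  have : Countable (Option (D × ℕ)) := by
    have := hD.to_subtype
    infer_instance
  obtain ⟨e, he⟩ := exists_surjective_nat (Option (D × ℕ))
  obtain ⟨W', hW', hWV'⟩ := exists_isNormalSequence
    (fun n => W n ∩ (e n).elim univ fun p => T (p.1, p.2)) fun n =>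
      inter_mem (hW.mem_nhds n) <| by
        cases h : e n with
        | none => simp
        | some p => simpa using hT (p.1, p.2)
  have hfix (g : G) (hg : g ∈ ⋂ n, W' n) (x : X) : g • x = x := by
    have hcl : IsClosed {x : X | g • x = x} :=
      isClosed_eq (continuous_const_smul g) continuous_id
    refine hcl.closure_subset_iff.2 ?_ (hdense x)
    rintro _ ⟨d, hdD, k, hk, rfl⟩
    have hfixd : (k⁻¹ * g * k) • d = d := by
      by_contra hne
      obtain ⟨m, -, hm⟩ := (hB d).1.mem_iff.1 (isOpen_compl_singleton.mem_nhds (Ne.symm hne))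
      obtain ⟨n, hn⟩ := he (some (⟨d, hdD⟩, m))
      have hgT := (hWV' n (mem_iInter.1 hg n)).2
      simp only [hn] at hgT
      exact hm (hgT k (mem_iInter.2 hk)) rfl
    simpa [mul_smul, inv_smul_eq_iff] using hfixd
  refine hd.metrizableSpace_of_isNormalSequence hW' fun E hE => ?_
  obtain ⟨E', hE'o, hdiag, hE'⟩ := mem_nhdsSet_iff_exists.1 hE
  have ho : IsOpen {g : G | ∀ x ∈ (univ : Set X), (x, g • x) ∈ E'} := by
    refine isOpen_iff_eventually.2 fun g hg =>
      isCompact_univ.eventually_forall_of_forall_eventually fun x hx => ?_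
    have hc : Continuous fun z : G × X => (z.2, z.1 • z.2) := by fun_prop
    exact hc.continuousAt.eventually (hE'o.mem_nhds (hg x hx))
  obtain ⟨n, hn⟩ := hW'.exists_subset
    (fun n => (hWV' n).trans (inter_subset_left.trans (hWV n))) hF ho
    fun g hg x _ => hdiag (hfix g hg x).symm
  exact ⟨n, fun g hg x => hE' (hn hg x (mem_univ x))⟩

end Metrizability

/-! ### Reduction to countably many coordinates -/

theorem MulAction.metrizableSpace_of_isInducing {G P X : Type*} [Group G] [TopologicalSpace G]
    [IsTopologicalGroup G] [Group P] [TopologicalSpace P] [IsTopologicalGroup P]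
    (hP : HasCompleteSequenceAtOne P) {π : G →* P} (hπ : IsInducing π)
    [TopologicalSpace X] [CompactSpace X] [T2Space X] [FirstCountableTopology X]
    [MulAction G X] [ContinuousConstSMul G X] [MulAction.IsPretransitive G X]
    (hd : IsDOpenAction G X) {x₀ : X} (h₀ : Tendsto (fun g : G => g • x₀) (𝓝 1) (𝓝 x₀)) :
    TopologicalSpace.MetrizableSpace X := by
  have := hd.continuousSMul h₀
  let Q := π.range.topologicalClosure
  have hQ (g : G) : π g ∈ Q := π.range.le_topologicalClosure ⟨g, rfl⟩
  let i : G →* Q := π.codRestrict Q hQ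
  have hi : IsDenseInducing i := by
    refine ⟨hπ.codRestrict hQ, fun q => ?_⟩
    rw [IsInducing.subtypeVal.closure_eq_preimage_closure_image]
    have hrange : Subtype.val '' range i = (π.range : Set P) := by
      rw [← range_comp]
      rfl
    exact closure_mono hrange.ge q.2
  obtain ⟨_, _, hact⟩ := exists_continuousSMul_extension (X := X) i hi
  refine IsDOpenAction.metrizableSpace (G := Q)
    (hP.subgroup Q π.range.isClosed_topologicalClosure) fun x O hO => ?_
  have hO' : i ⁻¹' O ∈ 𝓝 (1 : G) :=
    hi.continuous.continuousAt.preimage_mem_nhds (by rwa [map_one])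
  refine interior_mono (closure_mono ?_) (hd x _ hO')
  rintro _ ⟨g, hg, rfl⟩
  exact ⟨i g, hg, hact g x⟩

theorem Subgroup.exists_countable_coordinates {ι : Type*} {Γ : ι → Type*} [∀ i, Group (Γ i)]
    [∀ i, TopologicalSpace (Γ i)] (G : Subgroup (∀ i, Γ i)) (S : ℕ → Set G)
    (hS : ∀ n, S n ∈ 𝓝 (1 : G)) :
    ∃ J : Set ι, J.Countable ∧
      ∀ n, S n ∈ Filter.comap (fun (g : G) (j : J) => (g : ∀ i, Γ i) j) (𝓝 1) := by
  have key (n : ℕ) : ∃ F : Set ι, F.Finite ∧ ∃ t : ∀ i, Set (Γ i), (∀ i, t i ∈ 𝓝 1) ∧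
      ∀ g : G, (∀ i ∈ F, (g : ∀ i, Γ i) i ∈ t i) → g ∈ S n := by
    obtain ⟨U, hU, hUS⟩ := mem_nhds_subtype _ _ _ |>.1 (hS n)
    rw [Subgroup.coe_one, nhds_pi, Filter.mem_pi] at hU
    obtain ⟨F, hF, t, ht, htU⟩ := hU
    exact ⟨F, hF, t, ht, fun g hg => hUS (htU hg)⟩
  choose F hF t ht h using key
  refine ⟨⋃ n, F n, countable_iUnion fun n => (hF n).countable, fun n => ?_⟩
  let F' : Set (⋃ n, F n) := Subtype.val ⁻¹' F n
  have hF' : F'.Finite := (hF n).preimage Subtype.val_injective.injOn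
  refine ⟨F'.pi fun j => t n j, set_pi_mem_nhds hF' fun j _ => ht n j, fun g hg => h n g ?_⟩
  exact fun i hi => hg ⟨i, mem_iUnion.2 ⟨n, hi⟩⟩ hi

theorem HasTransitiveDOpenAction.metrizableSpace {X : Type*} [TopologicalSpace X]
    [CompactSpace X] [T2Space X] [FirstCountableTopology X]
    {ι : Type*} {Γ : ι → Type*} [∀ i, Group (Γ i)] [∀ i, TopologicalSpace (Γ i)]
    [∀ i, IsTopologicalGroup (Γ i)] (hΓ : ∀ i, IsCechComplete (Γ i))
    (G : Subgroup (∀ i, Γ i)) (hX : HasTransitiveDOpenAction G X) :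
    TopologicalSpace.MetrizableSpace X := by
  obtain ⟨_, _, _, hd⟩ := hX
  rcases isEmpty_or_nonempty X with _ | ⟨⟨x₀⟩⟩
  · infer_instance
  obtain ⟨B, hB⟩ := (𝓝 x₀).exists_antitone_basis
  have horbit : Tendsto (fun g : G => g • x₀) (𝓝 1) (𝓝 x₀) := by
    have : Continuous fun g : G => g • x₀ := by fun_prop
    simpa using this.tendsto 1
  obtain ⟨J, hJ, hS⟩ := G.exists_countable_coordinates (fun n => {g | g • x₀ ∈ B n})
    fun n => horbit (hB.mem n)
  have := hJ.to_subtype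
  let π : G →* ∀ j : J, Γ j :=
    { toFun := fun g j => (g : ∀ i, Γ i) j
      map_one' := rfl
      map_mul' := fun _ _ => rfl }
  have hπ : Continuous π :=
    continuous_pi fun j => (continuous_apply (j : ι)).comp continuous_subtype_val
  have hP : HasCompleteSequenceAtOne (∀ j : J, Γ j) :=
    .pi fun j => (hΓ j).hasCompleteSequenceAtOne
  refine @MulAction.metrizableSpace_of_isInducing G (∀ j : J, Γ j) X _
    (TopologicalSpace.induced π inferInstance) (topologicalGroup_induced π) _ _ _ hP π
    (@IsInducing.mk _ _ (_) _ _ rfl) _ _ _ _ _ _ _ ?_ x₀ ?_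
  -- The induced topology is coarser, so `d`-openness is inherited.
  · exact fun x O hO => hd x O (nhds_mono hπ.le_induced hO)
  · rw [nhds_induced, map_one]
    exact hB.1.tendsto_right_iff.2 fun n _ => hS n

theorem IsDOpenAction.quotient {G : Type*} [Group G] [TopologicalSpace G] [ContinuousMul G]
    (H : Subgroup G) : IsDOpenAction G (G ⧸ H) := by
  intro x O hO
  obtain ⟨a, rfl⟩ := QuotientGroup.mk_surjective x
  refine interior_mono subset_closure (mem_interior_iff_mem_nhds.2 ?_)
  have hopen : IsOpenMap fun g : G => g • (a : G ⧸ H) :=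
    QuotientGroup.isOpenMap_coe.comp (isOpenMap_mul_right a)
  simpa using hopen.image_mem_nhds hO

theorem theorem4 {X : Type*} [TopologicalSpace X] [CompactSpace X] [T2Space X]
    [FirstCountableTopology X]
    {ι : Type*} {Γ : ι → Type*} [∀ i, Group (Γ i)] [∀ i, TopologicalSpace (Γ i)]
    [∀ i, IsTopologicalGroup (Γ i)] (hΓ : ∀ i, IsCechComplete (Γ i))
    (G : Subgroup (∀ i, Γ i))
    (hX : IsCosetSpaceOf G X ∨ HasTransitiveDOpenAction G X) :
    TopologicalSpace.MetrizableSpace X := by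
  rcases hX with ⟨H, ⟨e⟩⟩ | hX
  · have := e.compactSpace
    have := e.t2Space
    have := e.symm.isInducing.firstCountableTopology
    have : TopologicalSpace.MetrizableSpace (G ⧸ H) :=
      HasTransitiveDOpenAction.metrizableSpace hΓ G
        ⟨inferInstance, inferInstance, inferInstance, .quotient H⟩
    exact e.isEmbedding.metrizableSpace
  · exact hX.metrizableSpace hΓ
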